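/- Let $\lambda$ be a $\sigma$-finite measure on $\mathbb R$, let $\Theta\subset\mathbb R$ be a compact set with non-empty interior, and let $\{f(\cdot,\theta)\}_{\theta\in\Theta}$ be probability densities on $\mathbb R$ with respect to $\lambda$. For $\theta\in\Theta$ put $F(x,\theta)=\int_{(-\infty,x]} f(y,\theta)\,d\lambda(y)$, and for a finitely supported probability measure $G$ on $\Theta$ put $F(x,G)=\int_\Theta F(x,\theta)\,dG(\theta)$. Let $\mathcal G_{\le m}$ be the set of probability measures on $\Theta$ whose support has at least $1$ and at most $m$ points, let $\|\cdot\|_\infty$ be the supremum norm over $x\in\mathbb R$, and let $W(G_1,G_2)=\inf_\Pi\int|\theta-\theta'|\,d\Pi(\theta,\theta')$, the infimum being over all couplings $\Pi$ of $G_1$ and $G_2$. Derivatives in $\theta$ are understood as follows: each $F(x,\cdot)$ is the restriction to $\Theta$ of a function, still written $F(x,\cdot)$, on the smallest interval $I\supseteq\Theta$ (nothing is extended if $\Theta$ is an interval), and $F^{(p)}(x,\theta)$ is its $p$-th derivative in $\theta$ on $I$, one-sided at the endpoints of $I$. Assume B(2), that is: 1. for every $x$, $F(x,\cdot)$ is twice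 differentiable on $I$; 2. the family is $2$-strongly identifiable: for every finite set of distinct points $\theta_1,\dots,\theta_r\in\Theta$ and all real $\alpha_{p,j}$, if $\big\|\sum_{p=0}^{2}\sum_{j=1}^{r}\alpha_{p,j}F^{(p)}(\cdot,\theta_j)\big\|_\infty=0$ then all $\alpha_{p,j}$ are $0$; 3. there is $\omega:\mathbb R\to\mathbb R$ with $\lim_{h\to0}\omega(h)=0$ and $\sup_x|F^{(2)}(x,\theta_2)-F^{(2)}(x,\theta_1)|\le\omega(\theta_2-\theta_1)$ for all $\theta_1,\theta_2\in\Theta$. Let $m$ be a natural number and $G_0\in\mathcal G_{\le m}$. Then there are $\varepsilon>0$ and $\delta>0$ such that $$\|F(\cdot,G_1)-F(\cdot,G_0)\|_\infty\ \ge\ \delta\,W(G_1,G_0)^2\qquad\text{for all }G_1\in\mathcal G_{\le m}\text{ with }W(G_1,G_0)<\varepsilon .$$ -/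

import Mathlib

open MeasureTheory Filter Topology
open scoped ENNReal

namespace FiniteMixture

/-- `{f(·, θ)}_{θ ∈ Θ}` is a family of probability densities on `ℝ` with respect to `ν`;
`f x θ` is the value at the point `x` of the density with parameter `θ`. -/
structure IsDensityFamily (ν : Measure ℝ) (Θ : Set ℝ) (f : ℝ → ℝ → ℝ) : Prop where
  measurable : ∀ θ ∈ Θ, Measurable fun x => f x θ
  nonneg : ∀ θ ∈ Θ, ∀ x, 0 ≤ f x θ
  lintegral_eq_one : ∀ θ ∈ Θ, ∫⁻ x, ENNReal.ofReal (f x θ) ∂ν = 1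

/-- The distribution function `F(x, θ) = ∫_{-∞}^x f(y, θ) dν(y)`. -/
noncomputable def distFun (ν : Measure ℝ) (f : ℝ → ℝ → ℝ) (x θ : ℝ) : ℝ :=
  ∫ y in Set.Iic x, f y θ ∂ν

/-- The distribution function of the mixture, `F(x, G) = ∫_Θ F(x, θ) dG(θ)`. -/
noncomputable def mixDistFun (ν : Measure ℝ) (Θ : Set ℝ) (f : ℝ → ℝ → ℝ) (x : ℝ)
    (G : Measure ℝ) : ℝ :=
  ∫ θ in Θ, distFun ν f x θ ∂G

/-- The probability measures on `Θ` whose support consists of exactly `m` points. -/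
def mixingExactly (Θ : Set ℝ) (m : ℕ) : Set (Measure ℝ) :=
  {G | IsProbabilityMeasure G ∧ ∃ S : Finset ℝ,
    (S : Set ℝ) ⊆ Θ ∧ S.card = m ∧ (∀ θ ∈ S, 0 < G {θ}) ∧ G (S : Set ℝ)ᶜ = 0}

/-- The mixing distributions on `Θ` with between `1` and `m` support points. -/
def mixingAtMost (Θ : Set ℝ) (m : ℕ) : Set (Measure ℝ) :=
  ⋃ j ∈ Set.Icc 1 m, mixingExactly Θ j

/-- The `L¹`-transportation (Wasserstein) distance: the infimum of the expected distance over
all couplings of `G₁` and `G₂`. -/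
noncomputable def wasserstein (G₁ G₂ : Measure ℝ) : ℝ≥0∞ :=
  ⨅ (P : Measure (ℝ × ℝ)) (_ : P.fst = G₁ ∧ P.snd = G₂), ∫⁻ p, edist p.1 p.2 ∂P

/-- The supremum norm of a function on the real line, with values in `[0, ∞]`. -/
noncomputable def supNorm (g : ℝ → ℝ) : ℝ≥0∞ :=
  ⨆ x, ‖g x‖ₑ

/-- The derivative `H^{(p)}(x, θ)` with respect to the parameter `θ`, for `H(x, ·)` defined on
the smallest interval containing `Θ`. It is one-sided at the endpoints of that interval. -/
noncomputable def paramDeriv (Θ : Set ℝ) (H : ℝ → ℝ → ℝ) (p : ℕ) (x θ : ℝ) : ℝ :=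
  iteratedDerivWithin p (H x) (convexHull ℝ Θ) θ

/-- `H(x, ·)` is `k` times differentiable on the smallest interval containing `Θ`, for all `x`. -/
def IsParamDifferentiable (k : ℕ) (Θ : Set ℝ) (H : ℝ → ℝ → ℝ) : Prop :=
  ∀ x, ∀ p < k, DifferentiableOn ℝ (paramDeriv Θ H p x) (convexHull ℝ Θ)

/-- `k`-strong identifiability of `{H(·, θ)}_{θ ∈ Θ}`: the functions `H^{(p)}(·, θ)`, `p ≤ k`,
at finitely many distinct points `θ` of `Θ` satisfy no nontrivial linear relation. -/
def IsStronglyIdentifiable (k : ℕ) (Θ : Set ℝ) (H : ℝ → ℝ → ℝ) : Prop :=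
  ∀ S : Finset ℝ, (S : Set ℝ) ⊆ Θ → ∀ α : ℕ → ℝ → ℝ,
    supNorm (fun x => ∑ p ∈ Finset.range (k + 1), ∑ θ ∈ S, α p θ * paramDeriv Θ H p x θ) = 0 →
      ∀ p ≤ k, ∀ θ ∈ S, α p θ = 0

/-- `H^{(k)}(x, ·)` has on `Θ` a modulus of continuity that does not depend on `x`. -/
def HasUniformModulus (k : ℕ) (Θ : Set ℝ) (H : ℝ → ℝ → ℝ) : Prop :=
  ∃ ω : ℝ → ℝ, Tendsto ω (𝓝 0) (𝓝 0) ∧ ∀ θ₁ ∈ Θ, ∀ θ₂ ∈ Θ, ∀ x,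
    |paramDeriv Θ H k x θ₂ - paramDeriv Θ H k x θ₁| ≤ ω (θ₂ - θ₁)

/-- Assumption B(`k`) for the densities `f(·, θ)`, `θ ∈ Θ`. The parameter set `Θ` may have gaps
and isolated points, where derivatives of a function given on `Θ` alone would make no sense or
would not control its increments; so the maps `F(x, ·)` are understood to be given on the smallest
interval containing `Θ`, by functions `H(x, ·)` that equal `F(x, ·)` on `Θ`. If `Θ` is an
interval, then `H` is just `F` and the derivatives are those of `F(x, ·)` on `Θ`. -/
def AssumptionB (k : ℕ) (ν : Measure ℝ) (Θ : Set ℝ) (f : ℝ → ℝ → ℝ) : Prop :=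
  ∃ H : ℝ → ℝ → ℝ, (∀ x, ∀ θ ∈ Θ, H x θ = distFun ν f x θ) ∧
    IsParamDifferentiable k Θ H ∧ IsStronglyIdentifiable k Θ H ∧ HasUniformModulus k Θ H

end FiniteMixture

namespace FiniteMixture

/-! If no constant works, there are mixtures G_n with at most `m` atoms whose distance to G₀ in sup
norm is below W²/(n+1). By compactness of Θ their atoms converge along an ultrafilter to points `τ
i`. Expanding F(x, G_n) - F(x, G₀) to second order about the set `T` of these limits and the atoms
of G₀ leaves a linear combination of F, F', F'' at `T`; let M_n be the sum of the absolute values of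
its coefficients. The second-order coefficients are sums of nonnegative terms w(a-τ)²/2, so nothing
cancels. Hence they dominate the Taylor remainder (`abs_sum_mul_le_of_abs_le`) and, together with
the mass discrepancies of order zero, W² (`exists_wasserstein_le_and_sq_le`). Thus the combination
is o(M_n) at each x. Dividing by M_n and passing to the limit gives a vanishing combination whose
coefficients have absolute sum 1, against strong identifiability. -/

/-! ### Taylor expansion in the parameter -/

/-- The second order Taylor formula with Peano remainder, within a convex set. -/
theorem taylor_two_isLittleO {s : Set ℝ} (hs : Convex ℝ s) {f f' : ℝ → ℝ} {t b : ℝ}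
    (ht : t ∈ s) (hf : ∀ y ∈ s, HasDerivWithinAt f (f' y) s y) (hf' : HasDerivWithinAt f' b s t) :
    (fun y => f y - (f t + f' t * (y - t) + b * ((y - t) ^ 2 / 2))) =o[𝓝[s] t]
      fun y => (y - t) ^ 2 := by
  rw [Asymptotics.isLittleO_iff]
  intro c hc
  have h1 := Asymptotics.isLittleO_iff.1 (hasDerivWithinAt_iff_isLittleO.1 hf') hc
  obtain ⟨r, hr, hball⟩ := Metric.mem_nhdsWithin_iff.1 h1
  filter_upwards [inter_mem_nhdsWithin s (Metric.ball_mem_nhds t hr)] with y hy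
  have hsub : segment ℝ t y ⊆ s ∩ Metric.closedBall t |y - t| := by
    refine fun z hz => ⟨hs.segment_subset ht hy.1 hz, ?_⟩
    have := (convex_closedBall t |y - t|).segment_subset
      (Metric.mem_closedBall_self (abs_nonneg _)) (by simp [Real.dist_eq] : y ∈ _) hz
    exact this
  have hderiv : ∀ z ∈ segment ℝ t y,
      HasDerivWithinAt (fun y => f y - (f t + f' t * (y - t) + b * ((y - t) ^ 2 / 2)))
        (f' z - (f' t + b * (z - t))) (segment ℝ t y) z := by
    intro z hz
    have h := (hf z (hsub hz).1).mono (fun w hw => (hsub hw).1)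
    have h2 : HasDerivAt (fun y => f t + f' t * (y - t) + b * ((y - t) ^ 2 / 2))
        (f' t + b * (z - t)) z := by
      have hid := (hasDerivAt_id z).sub_const t
      have := ((hid.const_mul (f' t)).const_add (f t)).add (((hid.pow 2).div_const 2).const_mul b)
      exact this.congr_deriv (by simp)
    exact h.sub h2.hasDerivWithinAt
  -- Differentiability of f' at t makes the derivative of the remainder at most c|y - t| on the
  -- segment; the mean value inequality supplies the second factor |y - t|.
  have hbound : ∀ z ∈ segment ℝ t y, ‖f' z - (f' t + b * (z - t))‖ ≤ c * |y - t| := by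
    intro z hz
    have hzd : |z - t| ≤ |y - t| := by simpa [Real.dist_eq] using (hsub hz).2
    have hyr : |y - t| < r := by simpa [Real.dist_eq] using hy.2
    have : z ∈ Metric.ball t r ∩ s := ⟨by simpa [Real.dist_eq] using hzd.trans_lt hyr, (hsub hz).1⟩
    have h := hball this
    simp only [Set.mem_ofPred_eq, smul_eq_mul, Real.norm_eq_abs] at h ⊢
    calc |f' z - (f' t + b * (z - t))| = |f' z - f' t - (z - t) * b| := by ring_nf
      _ ≤ c * |z - t| := h
      _ ≤ _ := by gcongr
  have := (convex_segment t y).norm_image_sub_le_of_norm_hasDerivWithin_le hderiv hbound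
    (left_mem_segment ℝ t y) (right_mem_segment ℝ t y)
  simp only [Real.norm_eq_abs] at this ⊢
  rw [abs_pow, pow_two |y - t|, ← mul_assoc]
  simpa using this

theorem paramDeriv_taylor_two {Θ : Set ℝ} {H : ℝ → ℝ → ℝ} (hH : IsParamDifferentiable 2 Θ H)
    (x : ℝ) {t : ℝ} (ht : t ∈ Θ) :
    (fun y => H x y - (H x t + paramDeriv Θ H 1 x t * (y - t)
      + paramDeriv Θ H 2 x t * ((y - t) ^ 2 / 2))) =o[𝓝[Θ] t] fun y => (y - t) ^ 2 := by
  have h0 : paramDeriv Θ H 0 x = H x := by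
    ext y; simp [paramDeriv]
  have key : ∀ p < 2, ∀ y ∈ convexHull ℝ Θ,
      HasDerivWithinAt (paramDeriv Θ H p x) (paramDeriv Θ H (p + 1) x y) (convexHull ℝ Θ) y := by
    intro p hp y hy
    have := (hH x p hp y hy).hasDerivWithinAt
    rwa [paramDeriv, iteratedDerivWithin_succ]
  refine (taylor_two_isLittleO (convex_convexHull ℝ Θ) (subset_convexHull ℝ Θ ht)
    (fun y hy => ?_) (key 1 (by norm_num) t (subset_convexHull ℝ Θ ht))).mono
    (nhdsWithin_mono t (subset_convexHull ℝ Θ))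
  have := key 0 (by norm_num) y hy
  rwa [h0] at this

/-! ### Transport between finitely supported distributions -/

/-- The measure with atoms `w i` at `a i`. -/
noncomputable def atomic {ι : Type*} [Fintype ι] (w a : ι → ℝ) : Measure ℝ :=
  ∑ i, ENNReal.ofReal (w i) • Measure.dirac (a i)

theorem wasserstein_atomic_le {ι κ : Type*} [Fintype ι] [Fintype κ] {w a : ι → ℝ} {v b : κ → ℝ}
    {q : ι → κ → ℝ} (hq : ∀ i k, 0 ≤ q i k) (hw : ∀ i, ∑ k, q i k = w i)
    (hv : ∀ k, ∑ i, q i k = v k) :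
    wasserstein (atomic w a) (atomic v b) ≤ ENNReal.ofReal (∑ i, ∑ k, q i k * |a i - b k|) := by
  let P : Measure (ℝ × ℝ) := ∑ i, ∑ k, ENNReal.ofReal (q i k) • Measure.dirac (a i, b k)
  have h1 : P.fst = atomic w a := by
    simp only [P, Measure.fst, Measure.map_finset_sum measurable_fst.aemeasurable,
      Measure.map_smul, Measure.map_dirac' measurable_fst, atomic, ← hw]
    refine Finset.sum_congr rfl fun i _ => ?_
    rw [ENNReal.ofReal_sum_of_nonneg fun k _ => hq i k, Finset.sum_smul]
  have h2 : P.snd = atomic v b := by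
    simp only [P, Measure.snd, Measure.map_finset_sum measurable_snd.aemeasurable,
      Measure.map_smul, Measure.map_dirac' measurable_snd, atomic, ← hv]
    rw [Finset.sum_comm]
    refine Finset.sum_congr rfl fun k _ => ?_
    rw [ENNReal.ofReal_sum_of_nonneg fun i _ => hq i k, Finset.sum_smul]
  refine (iInf₂_le P ⟨h1, h2⟩).trans (le_of_eq ?_)
  rw [ENNReal.ofReal_sum_of_nonneg fun i _ =>
    Finset.sum_nonneg fun k _ => mul_nonneg (hq i k) (abs_nonneg _)]
  simp only [P, lintegral_finsetSum_measure, lintegral_smul_measure, smul_eq_mul]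
  refine Finset.sum_congr rfl fun i _ => ?_
  rw [ENNReal.ofReal_sum_of_nonneg fun k _ => mul_nonneg (hq i k) (abs_nonneg _)]
  refine Finset.sum_congr rfl fun k _ => ?_
  rw [lintegral_dirac' _ (by fun_prop), edist_dist, Real.dist_eq, ENNReal.ofReal_mul (hq i k)]

/-- A coupling of two finite distributions which moves the mass `w i` to the point `τ i` as far as
the target `v` has room for it. -/
theorem exists_coupling {ι κ : Type*} [Fintype ι] [Fintype κ] [DecidableEq κ] {w : ι → ℝ}
    {v : κ → ℝ} (hw : ∀ i, 0 ≤ w i) (hv : ∀ k, 0 ≤ v k) (hw1 : ∑ i, w i = 1) (hv1 : ∑ k, v k = 1)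
    (τ : ι → κ) {c : ι → κ → ℝ} {D : ℝ} (hc : ∀ i k, 0 ≤ c i k) (hcD : ∀ i k, c i k ≤ D) :
    ∃ q : ι → κ → ℝ, (∀ i k, 0 ≤ q i k) ∧ (∀ i, ∑ k, q i k = w i) ∧ (∀ k, ∑ i, q i k = v k) ∧
      ∑ i, ∑ k, q i k * c i k ≤ ∑ i, w i * c i (τ i) +
        D * ∑ k, |∑ i with τ i = k, w i - v k| := by
  set p : κ → ℝ := fun k => ∑ i with τ i = k, w i with hp
  have hp0 : ∀ k, 0 ≤ p k := fun k => Finset.sum_nonneg fun i _ => hw i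
  have hp1 : ∑ k, p k = 1 := by rw [← hw1, hp]; exact Finset.sum_fiberwise _ _ _
  set l : κ → ℝ := fun k => min (p k) (v k) with hl
  have hl0 : ∀ k, 0 ≤ l k := fun k => le_min (hp0 k) (hv k)
  have hlp : ∀ k, l k ≤ p k := fun k => min_le_left _ _
  have hlv : ∀ k, l k ≤ v k := fun k => min_le_right _ _
  -- The fraction of the mass sent to k that fits there. If `p k = 0` the quotient is 0, which is
  -- harmless since then `l k = 0`.
  set r : κ → ℝ := fun k => l k / p k with hr
  have hr0 : ∀ k, 0 ≤ r k := fun k => div_nonneg (hl0 k) (hp0 k)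
  have hr1 : ∀ k, r k ≤ 1 := fun k => div_le_one_of_le₀ (hlp k) (hp0 k)
  have hrp : ∀ k, p k * r k = l k := by
    intro k
    rcases eq_or_ne (p k) 0 with h | h
    · rw [h, zero_mul]; exact le_antisymm (hl0 k) ((hlp k).trans h.le)
    · exact mul_div_cancel₀ _ h
  have hfib : ∀ g : κ → ℝ, ∑ i, w i * g (τ i) = ∑ k, p k * g k := by
    intro g
    rw [← Finset.sum_fiberwise Finset.univ τ]
    refine Finset.sum_congr rfl fun k _ => ?_
    rw [hp, Finset.sum_mul]
    exact Finset.sum_congr rfl fun i hi => by rw [(Finset.mem_filter.1 hi).2]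
  set e : ℝ := ∑ k, (v k - l k) with he
  have he0 : 0 ≤ e := Finset.sum_nonneg fun k _ => sub_nonneg.2 (hlv k)
  have he' : e = 1 - ∑ k, l k := by rw [he, Finset.sum_sub_distrib, hv1]
  have hex : ∑ i, w i * (1 - r (τ i)) = e := by
    rw [hfib (fun k => 1 - r k), he']
    simp only [mul_sub, mul_one, hrp, Finset.sum_sub_distrib, hp1]
  have hnn : ∀ i, 0 ≤ w i * (1 - r (τ i)) := fun i => mul_nonneg (hw i) (sub_nonneg.2 (hr1 _))
  have hq2 : ∀ i k, 0 ≤ w i * (1 - r (τ i)) * ((v k - l k) / e) := fun i k =>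
    mul_nonneg (hnn i) (div_nonneg (sub_nonneg.2 (hlv k)) he0)
  have hrow : ∀ i, ∑ k, w i * (1 - r (τ i)) * ((v k - l k) / e) = w i * (1 - r (τ i)) := by
    intro i
    rw [← Finset.mul_sum, ← Finset.sum_div, ← he]
    rcases eq_or_ne e 0 with h | h
    · rw [h] at hex
      rw [(Finset.sum_eq_zero_iff_of_nonneg fun i _ => hnn i).1 hex i (Finset.mem_univ i), zero_mul]
    · rw [div_self h, mul_one]
  -- What fits stays at `τ i`; the surplus, of total mass `e`, is spread over the targets in
  -- proportion to their deficits. If `e = 0`, all surpluses and deficits vanish.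
  refine ⟨fun i k => (if τ i = k then w i * r k else 0) +
    w i * (1 - r (τ i)) * ((v k - l k) / e), fun i k => ?_, fun i => ?_, fun k => ?_, ?_⟩
  · refine add_nonneg ?_ (hq2 i k)
    split_ifs
    exacts [mul_nonneg (hw i) (hr0 k), le_rfl]
  · rw [Finset.sum_add_distrib, hrow, Finset.sum_ite_eq, if_pos (Finset.mem_univ _)]
    ring
  · rw [Finset.sum_add_distrib, ← Finset.sum_filter, ← Finset.sum_mul, ← Finset.sum_mul, hex,
      show (∑ i with τ i = k, w i) * r k = l k from hrp k]
    rcases eq_or_ne e 0 with h | h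
    · have := (Finset.sum_eq_zero_iff_of_nonneg fun k _ => sub_nonneg.2 (hlv k)).1
        (he.symm.trans h) k (Finset.mem_univ k)
      rw [h]; linarith
    · rw [mul_div_cancel₀ _ h]; ring
  · have hD : ∀ i, ∑ k, ((if τ i = k then w i * r k else 0) +
        w i * (1 - r (τ i)) * ((v k - l k) / e)) * c i k ≤
        w i * c i (τ i) + D * (w i * (1 - r (τ i))) := by
      intro i
      simp only [add_mul, ite_mul, zero_mul, Finset.sum_add_distrib, Finset.sum_ite_eq,
        Finset.mem_univ, if_true]
      refine add_le_add ?_ ?_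
      · exact mul_le_mul_of_nonneg_right (mul_le_of_le_one_right (hw i) (hr1 _)) (hc _ _)
      · rw [mul_comm D, ← hrow i, Finset.sum_mul]
        refine Finset.sum_le_sum fun k _ => ?_
        rw [hrow i]
        exact mul_le_mul_of_nonneg_left (hcD i k) (hq2 i k)
    refine (Finset.sum_le_sum fun i _ => hD i).trans ?_
    rw [Finset.sum_add_distrib, ← Finset.mul_sum, hex]
    obtain ⟨i⟩ : Nonempty ι := by
      by_contra h
      rw [not_nonempty_iff] at h
      simp at hw1
    have hD0 : 0 ≤ D := (hc i (τ i)).trans (hcD i (τ i))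
    gcongr
    rw [he]
    refine Finset.sum_le_sum fun k _ => ?_
    change v k - min (p k) (v k) ≤ |p k - v k|
    rcases le_total (p k) (v k) with h | h
    · rw [min_eq_left h, abs_sub_comm]; exact le_abs_self _
    · rw [min_eq_right h, sub_self]; exact abs_nonneg _

/-! ### Mixing distributions as weighted atoms -/

theorem atomic_compl_eq_zero {ι : Type*} [Fintype ι] {w a : ι → ℝ} {Θ : Set ℝ}
    (hΘ : MeasurableSet Θ) (ha : ∀ i, a i ∈ Θ) : atomic w a Θᶜ = 0 := by
  simp [atomic, Measure.finsetSum_apply, Measure.dirac_apply' _ hΘ.compl, ha]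

theorem mixDistFun_atomic {ι : Type*} [Fintype ι] {w a : ι → ℝ} {Θ : Set ℝ} (hΘ : MeasurableSet Θ)
    (ha : ∀ i, a i ∈ Θ) (hw : ∀ i, 0 ≤ w i) (ν : Measure ℝ) (f : ℝ → ℝ → ℝ) (x : ℝ) :
    mixDistFun ν Θ f x (atomic w a) = ∑ i, w i * distFun ν f x (a i) := by
  rw [mixDistFun, Measure.restrict_eq_self_of_ae_mem
    (mem_ae_iff.2 (atomic_compl_eq_zero hΘ ha)), atomic, integral_finsetSum_measure]
  · refine Finset.sum_congr rfl fun i _ => ?_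
    rw [integral_smul_measure, integral_dirac, ENNReal.toReal_ofReal (hw i), smul_eq_mul]
  · exact fun i _ => (integrable_dirac (by simp)).smul_measure ENNReal.ofReal_ne_top

theorem eq_sum_dirac_of_compl_eq_zero {G : Measure ℝ} {S : Finset ℝ} (h : G (S : Set ℝ)ᶜ = 0) :
    G = ∑ s ∈ S, G {s} • Measure.dirac s := by
  classical
  ext A hA
  have h1 : G A = G ((S.filter (· ∈ A) : Finset ℝ) : Set ℝ) := by
    refine measure_congr (ae_eq_set.2 ⟨measure_mono_null ?_ h, ?_⟩)
    · intro y hy; simp at hy ⊢; tauto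
    · rw [Set.sdiff_eq_empty.2, measure_empty]; intro y hy; simp at hy; exact hy.2
  rw [h1, ← sum_measure_singleton, Finset.sum_filter, Measure.finsetSum_apply]
  refine Finset.sum_congr rfl fun s _ => ?_
  by_cases hs : s ∈ A <;> simp [Measure.dirac_apply' _ hA, hs]

/-- Padding with weightless copies of a support point gives every mixture the same index set, so
that the atoms range over a fixed compact power of Θ. -/
theorem exists_eq_atomic_of_mem_mixingAtMost {Θ : Set ℝ} {m : ℕ} {G : Measure ℝ}
    (hG : G ∈ mixingAtMost Θ m) :
    ∃ w a : Fin m → ℝ, w ∈ stdSimplex ℝ (Fin m) ∧ (∀ i, a i ∈ Θ) ∧ G = atomic w a := by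
  simp only [mixingAtMost, Set.mem_iUnion, Set.mem_Icc, exists_prop] at hG
  obtain ⟨j, ⟨hj1, hjm⟩, hprob, S, hS, hcard, -, hcompl⟩ := hG
  obtain ⟨s₀, hs₀⟩ : S.Nonempty := Finset.card_pos.1 (by omega)
  obtain ⟨e⟩ : Nonempty (S ↪ Fin m) := Function.Embedding.nonempty_of_card_le (by simp; omega)
  have hw : ∀ s : S, Function.extend e (fun s : S => G.real {s.1}) 0 (e s) = G.real {s.1} :=
    fun s => e.injective.extend_apply _ _ s
  have hw0 : ∀ i ∉ Set.range e, Function.extend e (fun s : S => G.real {s.1}) 0 i = 0 :=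
    fun i hi => Function.extend_apply' _ _ _ hi
  have ha : ∀ s : S, Function.extend e (fun s : S => s.1) (fun _ => s₀) (e s) = s.1 :=
    fun s => e.injective.extend_apply _ _ s
  have ha0 : ∀ i ∉ Set.range e, Function.extend e (fun s : S => s.1) (fun _ => s₀) i = s₀ :=
    fun i hi => Function.extend_apply' _ _ _ hi
  have hG := eq_sum_dirac_of_compl_eq_zero hcompl
  refine ⟨Function.extend e (fun s : S => G.real {s.1}) 0,
    Function.extend e (fun s : S => s.1) (fun _ => s₀), ⟨fun i => ?_, ?_⟩, fun i => ?_, ?_⟩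
  · by_cases hi : i ∈ Set.range e
    · obtain ⟨s, rfl⟩ := hi
      rw [hw]; exact measureReal_nonneg
    · rw [hw0 i hi]
  · rw [← Fintype.sum_of_injective e e.injective (fun s : S => G.real {s.1}) _ hw0
      fun s => (hw s).symm]
    have h1 : G (S : Set ℝ) = 1 := (prob_compl_eq_zero_iff S.measurableSet).1 hcompl
    rw [Finset.sum_coe_sort S fun s => G.real {s}, sum_measureReal_singleton, Measure.real, h1,
      ENNReal.toReal_one]
  · by_cases hi : i ∈ Set.range e
    · obtain ⟨s, rfl⟩ := hi
      rw [ha]; exact hS s.2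
    · rw [ha0 i hi]; exact hS hs₀
  · rw [atomic, ← Fintype.sum_of_injective e e.injective
      (fun s : S => G {s.1} • Measure.dirac s.1) _ (fun i hi => ?_) fun s => ?_]
    · rw [Finset.sum_coe_sort S fun s => G {s} • Measure.dirac s]
      exact hG
    · rw [hw0 i hi, ENNReal.ofReal_zero, zero_smul]
    · rw [hw, ha, ofReal_measureReal]

theorem atomic_eq_atomic_fiber {ι : Type*} [Fintype ι] {w a : ι → ℝ} (hw : ∀ i, 0 ≤ w i)
    {T : Finset ℝ} (ha : ∀ i, a i ∈ T) :
    atomic w a = atomic (fun t : T => ∑ i with a i = t, w i) (fun t : T => (t : ℝ)) := by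
  rw [atomic, atomic, Finset.sum_coe_sort T fun t =>
    ENNReal.ofReal (∑ i with a i = t, w i) • Measure.dirac t,
    ← Finset.sum_fiberwise_of_maps_to (fun i _ => ha i)]
  refine Finset.sum_congr rfl fun t _ => ?_
  rw [ENNReal.ofReal_sum_of_nonneg fun i _ => hw i, Finset.sum_smul]
  exact Finset.sum_congr rfl fun i hi => by rw [(Finset.mem_filter.1 hi).2]

/-! ### Coefficients of the expansion about the limit atoms -/

/-- The coefficient of the `p`-th derivative at `t` when the mixture with weights `w` and atoms `a`
is expanded around the points `τ` and the mixture with weights `v` is subtracted. -/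
noncomputable def taylorCoeff {ι : Type*} [Fintype ι] (w a τ : ι → ℝ) (v : ℝ → ℝ) (p : ℕ)
    (t : ℝ) : ℝ :=
  ∑ i with τ i = t, w i * ((a i - t) ^ p / p.factorial) - if p = 0 then v t else 0

theorem sum_mul_sub_sum_mul_eq_taylorCoeff {ι : Type*} [Fintype ι] (w a τ : ι → ℝ) (v : ℝ → ℝ)
    {T : Finset ℝ} (hτ : ∀ i, τ i ∈ T) (k : ℕ) (F : ℝ → ℝ) (d : ℕ → ℝ → ℝ) (hd : d 0 = F) :
    ∑ i, w i * F (a i) - ∑ t ∈ T, v t * F t =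
      ∑ p ∈ Finset.range (k + 1), ∑ t ∈ T, taylorCoeff w a τ v p t * d p t +
      ∑ i, w i * (F (a i) - ∑ p ∈ Finset.range (k + 1),
        d p (τ i) * ((a i - τ i) ^ p / p.factorial)) := by
  have h1 : ∀ p, ∑ t ∈ T, taylorCoeff w a τ v p t * d p t =
      ∑ i, w i * (d p (τ i) * ((a i - τ i) ^ p / p.factorial)) -
        if p = 0 then ∑ t ∈ T, v t * F t else 0 := by
    intro p
    simp only [taylorCoeff, sub_mul, Finset.sum_sub_distrib]
    congr 1
    · rw [← Finset.sum_fiberwise_of_maps_to (fun i _ => hτ i)]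
      refine Finset.sum_congr rfl fun t _ => ?_
      rw [Finset.sum_mul]
      refine Finset.sum_congr rfl fun i hi => ?_
      rw [(Finset.mem_filter.1 hi).2]; ring
    · split_ifs with hp
      · rw [hp, hd]
      · simp
  simp only [h1, Finset.sum_sub_distrib, mul_sub, Finset.mul_sum]
  rw [Finset.sum_comm (s := Finset.range (k + 1)), Finset.sum_ite_eq', if_pos (by simp)]
  ring

theorem sq_sum_mul_abs_le {ι : Type*} [Fintype ι] {w : ι → ℝ} (hw : w ∈ stdSimplex ℝ ι)
    (x : ι → ℝ) : (∑ i, w i * |x i|) ^ 2 ≤ ∑ i, w i * x i ^ 2 := by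
  have := Finset.sum_sq_le_sum_mul_sum_of_sq_le_mul Finset.univ (fun i _ => hw.1 i)
    (fun i _ => mul_nonneg (hw.1 i) (sq_nonneg (x i))) (r := fun i => w i * |x i|)
    (fun i _ => le_of_eq (by rw [mul_pow, sq_abs]; ring))
  rwa [hw.2, one_mul] at this

/-- The transportation distance is controlled by the coefficients of the Taylor expansion. -/
theorem exists_wasserstein_le_and_sq_le {ι κ : Type*} [Fintype ι] [Fintype κ] {w a τ : ι → ℝ}
    {v b : κ → ℝ} (hw : w ∈ stdSimplex ℝ ι) (hv : v ∈ stdSimplex ℝ κ) {T : Finset ℝ}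
    (hτ : ∀ i, τ i ∈ T) (hb : ∀ i, b i ∈ T) {D : ℝ} (hD : ∀ i, ∀ t ∈ T, |a i - t| ≤ D) :
    ∃ W : ℝ, 0 ≤ W ∧ wasserstein (atomic w a) (atomic v b) ≤ ENNReal.ofReal W ∧
      W ^ 2 ≤ (4 + 4 * D ^ 2) * ∑ p ∈ Finset.range (2 + 1), ∑ t ∈ T,
        |taylorCoeff w a τ (fun t => ∑ j with b j = t, v j) p t| := by
  set u : ℝ → ℝ := fun t => ∑ j with b j = t, v j with hu
  have hu0 : ∀ t, 0 ≤ u t := fun t => Finset.sum_nonneg fun j _ => hv.1 j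
  have hu1 : ∑ t ∈ T, u t = 1 := by
    rw [← hv.2]; exact Finset.sum_fiberwise_of_maps_to (fun i _ => hb i) _
  obtain ⟨i₀⟩ : Nonempty ι := by
    by_contra h
    rw [not_nonempty_iff] at h
    simpa using hw.2
  have hD0 : 0 ≤ D := (abs_nonneg _).trans (hD i₀ _ (hτ i₀))
  obtain ⟨q, hq, hrow, hcol, hcost⟩ := exists_coupling (κ := T) (w := w) (v := fun t => u t) hw.1
    (fun t => hu0 t) hw.2 (by rw [Finset.sum_coe_sort T u, hu1]) (fun i => ⟨τ i, hτ i⟩)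
    (c := fun i t => |a i - t|) (D := D) (fun _ _ => abs_nonneg _) (fun i t => hD i t t.2)
  have hA : ∀ t, taylorCoeff w a τ u 0 t = ∑ i with τ i = t, w i - u t := by
    intro t; simp [taylorCoeff]
  set E := ∑ t ∈ T, |taylorCoeff w a τ u 0 t| with hE
  have hE0 : 0 ≤ E := Finset.sum_nonneg fun _ _ => abs_nonneg _
  -- Two probability vectors differ by at most 2 in total, so E² ≤ 2E: a linear bound in the
  -- coefficients.
  have hE2 : E ≤ 2 := by
    calc E ≤ ∑ t ∈ T, (∑ i with τ i = t, w i + u t) := Finset.sum_le_sum fun t _ => by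
          rw [hA]
          refine (abs_sub _ _).trans (le_of_eq ?_)
          rw [abs_of_nonneg (Finset.sum_nonneg fun i _ => hw.1 i), abs_of_nonneg (hu0 t)]
      _ = 2 := by
          rw [Finset.sum_add_distrib, hu1, Finset.sum_fiberwise_of_maps_to (fun i _ => hτ i), hw.2]
          norm_num
  set s := ∑ i, w i * |a i - τ i| with hs
  have hs0 : 0 ≤ s := Finset.sum_nonneg fun i _ => mul_nonneg (hw.1 i) (abs_nonneg _)
  -- Cauchy–Schwarz; the factor 2 undoes the 1/2! in the second-order coefficients.
  have hs2 : s ^ 2 ≤ 2 * ∑ t ∈ T, |taylorCoeff w a τ u 2 t| := by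
    refine (sq_sum_mul_abs_le hw _).trans ?_
    rw [← Finset.sum_fiberwise_of_maps_to (fun i _ => hτ i), Finset.mul_sum]
    refine Finset.sum_le_sum fun t _ => ?_
    refine le_trans (le_of_eq ?_) (mul_le_mul_of_nonneg_left (le_abs_self _) zero_le_two)
    simp only [taylorCoeff, OfNat.ofNat_ne_zero, if_false, sub_zero, Finset.mul_sum]
    refine Finset.sum_congr rfl fun i hi => ?_
    rw [(Finset.mem_filter.1 hi).2]
    simp [Nat.factorial]; ring
  refine ⟨s + D * E, by positivity, ?_, ?_⟩
  · rw [atomic_eq_atomic_fiber hv.1 hb]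
    refine (wasserstein_atomic_le hq hrow hcol).trans (ENNReal.ofReal_le_ofReal ?_)
    refine hcost.trans (le_of_eq ?_)
    rw [hs, hE, ← Finset.sum_coe_sort T]
    simp only [hA, Subtype.ext_iff]
  · have h1 : 0 ≤ ∑ t ∈ T, |taylorCoeff w a τ u 1 t| := Finset.sum_nonneg fun _ _ => abs_nonneg _
    have h2 : 0 ≤ ∑ t ∈ T, |taylorCoeff w a τ u 2 t| := Finset.sum_nonneg fun _ _ => abs_nonneg _
    rw [Finset.sum_range_succ, Finset.sum_range_succ, Finset.sum_range_one, ← hE]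
    calc (s + D * E) ^ 2 ≤ 2 * s ^ 2 + 2 * D ^ 2 * E ^ 2 := by nlinarith [sq_nonneg (s - D * E)]
      _ ≤ 2 * (2 * ∑ t ∈ T, |taylorCoeff w a τ u 2 t|) + 2 * D ^ 2 * (2 * E) := by
          gcongr; nlinarith
      _ ≤ _ := by nlinarith [sq_nonneg D, mul_nonneg (sq_nonneg D) h1, mul_nonneg (sq_nonneg D) h2]

/-- A sequence of remainders that is `o((a - τ)²)` pointwise is negligible against the
coefficients of the Taylor expansion. -/
theorem abs_sum_mul_le_of_abs_le {ι : Type*} [Fintype ι] {w a τ R : ι → ℝ} (v : ℝ → ℝ)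
    (hw : ∀ i, 0 ≤ w i) {T : Finset ℝ} (hτ : ∀ i, τ i ∈ T) {c : ℝ} (hc : 0 ≤ c)
    (hR : ∀ i, |R i| ≤ c * (a i - τ i) ^ 2) :
    |∑ i, w i * R i| ≤ 2 * c * ∑ t ∈ T, |taylorCoeff w a τ v 2 t| := by
  calc |∑ i, w i * R i| ≤ ∑ i, w i * (c * (a i - τ i) ^ 2) := by
        refine (Finset.abs_sum_le_sum_abs _ _).trans (Finset.sum_le_sum fun i _ => ?_)
        rw [abs_mul, abs_of_nonneg (hw i)]
        exact mul_le_mul_of_nonneg_left (hR i) (hw i)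
    _ ≤ _ := by
        rw [← Finset.sum_fiberwise_of_maps_to (fun i _ => hτ i), Finset.mul_sum]
        refine Finset.sum_le_sum fun t _ => ?_
        refine le_trans (le_of_eq ?_)
          (mul_le_mul_of_nonneg_left (le_abs_self _) (mul_nonneg zero_le_two hc))
        simp only [taylorCoeff, OfNat.ofNat_ne_zero, if_false, sub_zero, Finset.mul_sum]
        refine Finset.sum_congr rfl fun i hi => ?_
        rw [(Finset.mem_filter.1 hi).2]
        simp [Nat.factorial]; ring

/-! ### Compactness and contradiction -/

theorem Ultrafilter.exists_tendsto_of_abs_le_one {α : Type*} (L : Ultrafilter α) {z : α → ℝ}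
    (hz : ∀ n, |z n| ≤ 1) : ∃ l, Tendsto z L (𝓝 l) := by
  obtain ⟨l, -, hl⟩ := (isCompact_Icc (a := (-1 : ℝ)) (b := 1)).ultrafilter_le_nhds (L.map z)
    (le_principal_iff.2 (Ultrafilter.mem_map.2 (univ_mem' fun n => abs_le.1 (hz n))))
  exact ⟨l, hl⟩

end FiniteMixture

open FiniteMixture in
theorem theorem4p4 (ν : Measure ℝ) [SigmaFinite ν]
    (Θ : Set ℝ) (hΘ : IsCompact Θ) (hΘi : (interior Θ).Nonempty)
    (f : ℝ → ℝ → ℝ) (hf : FiniteMixture.IsDensityFamily ν Θ f)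
    (hB : FiniteMixture.AssumptionB 2 ν Θ f)
    (m : ℕ) (G₀ : Measure ℝ) (hG₀ : G₀ ∈ FiniteMixture.mixingAtMost Θ m) :
    ∃ ε δ : ℝ, 0 < ε ∧ 0 < δ ∧
      ∀ G₁ ∈ FiniteMixture.mixingAtMost Θ m,
        FiniteMixture.wasserstein G₁ G₀ < ENNReal.ofReal ε →
          ENNReal.ofReal δ * FiniteMixture.wasserstein G₁ G₀ ^ 2 ≤
            FiniteMixture.supNorm (fun x =>
              FiniteMixture.mixDistFun ν Θ f x G₁ - FiniteMixture.mixDistFun ν Θ f x G₀) := by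
  obtain ⟨H, hHF, hdiff, hid, -⟩ := hB
  obtain ⟨v, b, hv, hb, rfl⟩ := exists_eq_atomic_of_mem_mixingAtMost hG₀
  by_contra! hcon
  have hseq : ∀ n : ℕ, ∃ w a : Fin m → ℝ, w ∈ stdSimplex ℝ (Fin m) ∧ (∀ i, a i ∈ Θ) ∧
      supNorm (fun x => mixDistFun ν Θ f x (atomic w a) - mixDistFun ν Θ f x (atomic v b)) <
        ENNReal.ofReal (1 / ((n : ℝ) + 1)) * wasserstein (atomic w a) (atomic v b) ^ 2 := by
    intro n
    obtain ⟨G, hG, -, hlt⟩ := hcon 1 (1 / ((n : ℝ) + 1)) one_pos Nat.one_div_pos_of_nat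
    obtain ⟨w, a, hw, ha, rfl⟩ := exists_eq_atomic_of_mem_mixingAtMost hG
    exact ⟨w, a, hw, ha, hlt⟩
  choose w a hw ha hlt using hseq
  -- Along one ultrafilter all bounded sequences converge at once, so no successive subsequences are
  -- needed.
  let L : Ultrafilter ℕ := hyperfilter ℕ
  have hL : (L : Filter ℕ) ≤ atTop := Nat.hyperfilter_le_atTop
  obtain ⟨τ, hτΘ, hτ⟩ : ∃ τ : Fin m → ℝ, (∀ i, τ i ∈ Θ) ∧ Tendsto a L (𝓝 τ) := by
    obtain ⟨τ, h1, h2⟩ := (isCompact_univ_pi fun _ : Fin m => hΘ).ultrafilter_le_nhds (L.map a)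
      (le_principal_iff.2 (Ultrafilter.mem_map.2 (univ_mem' fun n => fun i _ => ha n i)))
    exact ⟨τ, fun i => h1 i trivial, h2⟩
  set T : Finset ℝ := Finset.univ.image τ ∪ Finset.univ.image b with hT
  have hτT : ∀ i, τ i ∈ T := fun i => by simp [hT]
  have hbT : ∀ i, b i ∈ T := fun i => by simp [hT]
  have hTΘ : (T : Set ℝ) ⊆ Θ := by
    intro t ht
    simp only [hT, Finset.coe_union, Finset.coe_image, Finset.coe_univ, Set.image_univ] at ht
    rcases ht with ⟨i, rfl⟩ | ⟨i, rfl⟩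
    exacts [hτΘ i, hb i]
  set u : ℝ → ℝ := fun t => ∑ j with b j = t, v j with hu
  set A : ℕ → ℕ → ℝ → ℝ := fun n => taylorCoeff (w n) (a n) τ u with hA
  set M : ℕ → ℝ := fun n => ∑ p ∈ Finset.range (2 + 1), ∑ t ∈ T, |A n p t| with hM
  have hM0 : ∀ n, 0 ≤ M n := fun n =>
    Finset.sum_nonneg fun _ _ => Finset.sum_nonneg fun _ _ => abs_nonneg _
  have hAM : ∀ n, ∀ p ∈ Finset.range (2 + 1), ∀ t ∈ T, |A n p t| ≤ M n := fun n p hp t ht =>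
    (Finset.single_le_sum (f := fun t => |A n p t|) (fun _ _ => abs_nonneg _) ht).trans
      (Finset.single_le_sum (f := fun p => ∑ t ∈ T, |A n p t|)
        (fun _ _ => Finset.sum_nonneg fun _ _ => abs_nonneg _) hp)
  set K : ℝ := 4 + 4 * Metric.diam Θ ^ 2 with hK
  -- Positivity comes from the strictness of the violated inequality: `M n = 0` would force its
  -- right side to vanish.
  have hbound : ∀ n x, 0 < M n ∧
      |∑ i, w n i * H x (a n i) - ∑ t ∈ T, u t * H x t| ≤ K * (1 / ((n : ℝ) + 1)) * M n := by
    intro n x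
    obtain ⟨W, hW0, hW, hW2⟩ := exists_wasserstein_le_and_sq_le (a := a n) (τ := τ) (hw n) hv hτT hbT
      (D := Metric.diam Θ) fun i t ht => by
        rw [← Real.dist_eq]; exact Metric.dist_le_diam_of_mem hΘ.isBounded (ha n i) (hTΘ ht)
    have hmix : ∑ i, w n i * H x (a n i) - ∑ t ∈ T, u t * H x t =
        mixDistFun ν Θ f x (atomic (w n) (a n)) - mixDistFun ν Θ f x (atomic v b) := by
      rw [mixDistFun_atomic hΘ.measurableSet (ha n) (hw n).1,
        mixDistFun_atomic hΘ.measurableSet hb hv.1,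
        ← Finset.sum_fiberwise_of_maps_to (fun i _ => hbT i) fun i => v i * distFun ν f x (b i)]
      congr 1
      · exact Finset.sum_congr rfl fun i _ => by rw [hHF x _ (ha n i)]
      · refine Finset.sum_congr rfl fun t ht => ?_
        rw [hu, Finset.sum_mul]
        refine Finset.sum_congr rfl fun i hi => ?_
        rw [(Finset.mem_filter.1 hi).2, hHF x t (hTΘ ht)]
    have hn : (0 : ℝ) < 1 / ((n : ℝ) + 1) := Nat.one_div_pos_of_nat
    have hlt' : ENNReal.ofReal |∑ i, w n i * H x (a n i) - ∑ t ∈ T, u t * H x t| <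
        ENNReal.ofReal (1 / ((n : ℝ) + 1) * W ^ 2) := by
      rw [hmix, ENNReal.ofReal_mul hn.le, ENNReal.ofReal_pow hW0, ← Real.enorm_eq_ofReal_abs]
      refine lt_of_le_of_lt ?_ ((hlt n).trans_le (by gcongr))
      exact le_iSup (fun x => ‖mixDistFun ν Θ f x (atomic (w n) (a n)) -
        mixDistFun ν Θ f x (atomic v b)‖ₑ) x
    have hlt2 := (ENNReal.ofReal_lt_ofReal_iff_of_nonneg (abs_nonneg _)).1 hlt'
    have hle : 1 / ((n : ℝ) + 1) * W ^ 2 ≤ K * (1 / ((n : ℝ) + 1)) * M n := by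
      calc _ ≤ 1 / ((n : ℝ) + 1) * (K * M n) := mul_le_mul_of_nonneg_left hW2 hn.le
        _ = _ := by ring
    refine ⟨(hM0 n).lt_of_ne fun h => ?_, hlt2.le.trans hle⟩
    rw [← h, mul_zero] at hle
    exact absurd ((abs_nonneg _).trans_lt hlt2) (not_lt.2 hle)
  have hlim : ∀ p t, ∃ l, p ∈ Finset.range (2 + 1) → t ∈ T →
      Tendsto (fun n => A n p t / M n) L (𝓝 l) := by
    intro p t
    by_cases h : p ∈ Finset.range (2 + 1) ∧ t ∈ T
    · obtain ⟨l, hl⟩ := Ultrafilter.exists_tendsto_of_abs_le_one L (z := fun n => A n p t / M n)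
        fun n => by
          rw [abs_div, abs_of_nonneg (hM0 n)]
          exact div_le_one_of_le₀ (hAM n p h.1 t h.2) (hM0 n)
      exact ⟨l, fun _ _ => hl⟩
    · exact ⟨0, fun hp ht => absurd ⟨hp, ht⟩ h⟩
  choose α hα using hlim
  have hsum : ∑ p ∈ Finset.range (2 + 1), ∑ t ∈ T, |α p t| = 1 := by
    refine tendsto_nhds_unique (f := fun n => ∑ p ∈ Finset.range (2 + 1), ∑ t ∈ T,
      |A n p t / M n|) (l := L) (tendsto_finsetSum _ fun p hp => tendsto_finsetSum _ fun t ht =>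
        (hα p t hp ht).abs) (tendsto_const_nhds.congr fun n => ?_)
    simp only [abs_div, abs_of_nonneg (hM0 n), ← Finset.sum_div]
    exact (div_self (hbound n 0).1.ne').symm
  have hrel : ∀ x, ∑ p ∈ Finset.range (2 + 1), ∑ t ∈ T, α p t * paramDeriv Θ H p x t = 0 := by
    intro x
    refine tendsto_nhds_unique (f := fun n => (∑ p ∈ Finset.range (2 + 1), ∑ t ∈ T,
      A n p t * paramDeriv Θ H p x t) / M n) (l := L) ?_ ?_
    · simp only [Finset.sum_div, mul_div_right_comm]
      exact tendsto_finsetSum _ fun p hp => tendsto_finsetSum _ fun t ht =>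
        (hα p t hp ht).mul_const _
    -- The combination is the mixture difference, eventually below (e/2)M_n, minus the remainder, at
    -- most 2(e/4)M_n. Convergence for each fixed x is enough.
    · rw [Metric.tendsto_nhds]
      intro e he
      have hrem : ∀ i, ∀ᶠ n in (L : Filter ℕ), |H x (a n i) - ∑ p ∈ Finset.range (2 + 1),
          paramDeriv Θ H p x (τ i) * ((a n i - τ i) ^ p / p.factorial)| ≤
            e / 4 * (a n i - τ i) ^ 2 := by
        intro i
        have h1 := Asymptotics.isLittleO_iff.1 (paramDeriv_taylor_two hdiff x (hτΘ i))
          (by positivity : 0 < e / 4)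
        have h2 : Tendsto (fun n => a n i) L (𝓝[Θ] (τ i)) :=
          tendsto_nhdsWithin_iff.2 ⟨(tendsto_pi_nhds.1 hτ) i, Eventually.of_forall fun n => ha n i⟩
        filter_upwards [h2.eventually h1] with n hn
        simpa [Finset.sum_range_succ, paramDeriv, Nat.factorial] using hn
      have hK0 : Tendsto (fun n : ℕ => K * (1 / ((n : ℝ) + 1))) L (𝓝 0) := by
        have := (tendsto_one_div_add_atTop_nhds_zero_nat (𝕜 := ℝ)).const_mul K
        rw [mul_zero] at this
        exact this.mono_left hL
      filter_upwards [eventually_all.2 hrem, hK0.eventually_lt_const (half_pos he)] with n h1 h2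
      obtain ⟨hMpos, hDn⟩ := hbound n x
      have hexp := sum_mul_sub_sum_mul_eq_taylorCoeff (w n) (a n) τ u hτT 2 (H x)
        (fun p t => paramDeriv Θ H p x t) (by ext t; simp [paramDeriv])
      have hR := abs_sum_mul_le_of_abs_le u (hw n).1 hτT (by positivity) h1
      have hR2 : ∑ t ∈ T, |A n 2 t| ≤ M n :=
        Finset.single_le_sum (f := fun p => ∑ t ∈ T, |A n p t|)
          (fun _ _ => Finset.sum_nonneg fun _ _ => abs_nonneg _) (by simp)
      rw [Real.dist_eq, sub_zero, abs_div, abs_of_pos hMpos, div_lt_iff₀ hMpos,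
        eq_sub_of_add_eq hexp.symm]
      refine (abs_sub _ _).trans_lt ?_
      have h3 : K * (1 / ((n : ℝ) + 1)) * M n < e / 2 * M n := mul_lt_mul_of_pos_right h2 hMpos
      have h4 : 2 * (e / 4) * ∑ t ∈ T, |A n 2 t| ≤ 2 * (e / 4) * M n := by gcongr
      linarith [hDn, hR]
  have hzero := hid T hTΘ α (by simp [supNorm, hrel])
  rw [Finset.sum_eq_zero fun p hp => Finset.sum_eq_zero fun t ht => by
    rw [hzero p (by simpa [Nat.lt_succ_iff] using hp) t ht, abs_zero]] at hsum
  exact zero_ne_one hsum
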